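/- Let $\phi$ be the standard normal density, $G$ the Laplace distribution with density $\gamma(u)=\tfrac12e^{-|u|}$, and $g=\phi*G$. For $n\ge 1$ and $\theta\in\mathbb{R}^n$ let $P_\theta$ (with expectation $E_\theta$) be the law of $X=(X_1,\dots,X_n)$ with independent $X_i\sim\mathcal N(\theta_i,1)$, and let $\ell_0[s]=\{\theta\in\mathbb{R}^n:\ \#\{i:\theta_i\ne 0\}\le s\}$. For $\alpha\in[0,1]$ consider the spike and slab prior $\Pi_\alpha=\bigotimes_{i=1}^n\{(1-\alpha)\delta_0+\alpha G\}$ on $\theta$. By Bayes' formula its posterior is $$\Pi_\alpha[\cdot\,|\,X]=\bigotimes_{i=1}^n\{(1-a_\alpha(X_i))\delta_0+a_\alpha(X_i)G_{X_i}\},\qquad a_\alpha(x)=\frac{\alpha g(x)}{(1-\alpha)\phi(x)+\alpha g(x)},$$ where $G_x$ has density $u\mapsto\phi(x-u)\gamma(u)/g(x)$. For $\alpha\in(0,1]$ let $t(\alpha)\ge0$ be the threshold such that the median of the coordinate posterior $(1-a_\alpha(x))\delta_0+a_\alpha(x)G_x$ is $0$ if and only if $|x|\le t(\alpha)$, and let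 $\alpha_n\in(0,1]$ be defined by $t(\alpha_n)=\sqrt{2\log n}$. Let $\hat\alpha=\hat\alpha(X)$ be a maximiser over $\alpha\in[\alpha_n,1]$ of the log-marginal likelihood $$\ell_n(\alpha;X)=\sum_{i=1}^n\log\big((1-\alpha)\phi(X_i)+\alpha g(X_i)\big).$$ Theorem. There exist $D>0$, $N_0>0$ and $c_0>0$ such that for all $n\ge N_0$ and all integers $s_n$ with $1\le s_n\le c_0n$ there exists $\theta_0\in\ell_0[s_n]$ such that $$E_{\theta_0}\int\|\theta-\theta_0\|^2\,d\Pi_{\hat\alpha}[\theta\,|\,X]\ \ge\ D\,s_n\,e^{\sqrt{\log(n/s_n)}}.$$ In particular, this posterior is suboptimal compared with the minimax rate $s_n\log(n/s_n)$: for every $K>0$ there is $c>0$ such that for all $n\ge N_0$ and all integers $s_n$ with $1\le s_n\le cn$ there is $\theta_0\in\ell_0[s_n]$ with $$E_{\theta_0}\int\|\theta-\theta_0\|^2\,d\Pi_{\hat\alpha}[\theta\,|\,X]\ \ge\ K\,s_n\log(n/s_n).$$ Here $\|\cdot\|$ is the Euclidean norm, and $\theta_0$ does not depend on the choice of the maximiser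 $\hat\alpha$ (which is unique for almost every $X$). -/

import Mathlib

open MeasureTheory ProbabilityTheory

namespace SpikeSlab

noncomputable section

/-- The standard normal density `φ`. -/
def phi (x : ℝ) : ℝ := gaussianPDFReal 0 1 x

/-- The density `γ` of the Laplace distribution with parameter `1`. -/
def laplaceDensity (u : ℝ) : ℝ := Real.exp (-|u|) / 2

/-- The slab distribution `G`, the Laplace distribution with parameter `1`. -/
def slab : Measure ℝ := volume.withDensity fun u => ENNReal.ofReal (laplaceDensity u)

/-- The convolution `g = φ * G`. -/
def g (x : ℝ) : ℝ := ∫ u, phi (x - u) ∂slab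

/-- The marginal density `(1 - α) φ(x) + α g(x)` of one observation, when its mean has the
spike and slab prior `(1 - α) δ₀ + α G`. -/
def marginalDensity (α x : ℝ) : ℝ := (1 - α) * phi x + α * g x

/-- The posterior weight `a_α(x)` of the slab. -/
def slabWeight (α x : ℝ) : ℝ := α * g x / marginalDensity α x

/-- The distribution `G_x`, with density `u ↦ φ(x - u) γ(u) / g(x)`. -/
def slabPosterior (x : ℝ) : Measure ℝ :=
  volume.withDensity fun u => ENNReal.ofReal (phi (x - u) * laplaceDensity u / g x)

/-- The posterior distribution of one coordinate, `(1 - a_α(x)) δ₀ + a_α(x) G_x`. -/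
def coordPosterior (α x : ℝ) : Measure ℝ :=
  ENNReal.ofReal (1 - slabWeight α x) • Measure.dirac 0 +
    ENNReal.ofReal (slabWeight α x) • slabPosterior x

/-- The posterior distribution `Π_α[· | X = x]` on `ℝⁿ` of the spike and slab prior
`⨂ᵢ ((1 - α) δ₀ + α G)`, given by Bayes' formula. -/
def posterior {n : ℕ} (α : ℝ) (x : Fin n → ℝ) : Measure (Fin n → ℝ) :=
  Measure.pi fun i => coordPosterior α (x i)

/-- `m` is a median of `μ`. -/
def IsMedian (μ : Measure ℝ) (m : ℝ) : Prop :=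
  1 / 2 ≤ μ (Set.Iic m) ∧ 1 / 2 ≤ μ (Set.Ici m)

/-- `t` is the threshold `t(α)`: the coordinatewise posterior median vanishes exactly for the
observations `x` with `|x| ≤ t`. -/
def IsMedianThreshold (α t : ℝ) : Prop :=
  0 ≤ t ∧ ∀ x : ℝ, IsMedian (coordPosterior α x) 0 ↔ |x| ≤ t

/-- The lower end point `α_n`, the (unique) weight in `(0, 1]` with `t(α_n) = √(2 log n)`. -/
def alphaLower (n : ℕ) : ℝ :=
  sInf {α | α ∈ Set.Ioc (0 : ℝ) 1 ∧ IsMedianThreshold α (Real.sqrt (2 * Real.log n))}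

/-- The log-marginal likelihood `ℓ_n(α; x)`. -/
def logMarginalLikelihood {n : ℕ} (x : Fin n → ℝ) (α : ℝ) : ℝ :=
  ∑ i, Real.log (marginalDensity α (x i))

/-- `α` maximises the log-marginal likelihood over `[α_n, 1]`. -/
def IsMMLE {n : ℕ} (x : Fin n → ℝ) (α : ℝ) : Prop :=
  α ∈ Set.Icc (alphaLower n) 1 ∧
    IsMaxOn (logMarginalLikelihood x) (Set.Icc (alphaLower n) 1) α

/-- The law `P_θ` of `X = θ + ε`, with `ε` a standard normal vector. -/
def law {n : ℕ} (θ : Fin n → ℝ) : Measure (Fin n → ℝ) :=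
  Measure.pi fun i => gaussianReal (θ i) 1

/-- The class `ℓ₀[s]` of vectors with at most `s` nonzero coordinates. -/
def nearlyBlack (n s : ℕ) : Set (Fin n → ℝ) :=
  {θ | (Finset.univ.filter fun i => θ i ≠ 0).card ≤ s}

/-- The expected posterior second moment `E_{θ₀} ∫ ‖θ - θ₀‖² dΠ_{α̂}(θ | X)` of the plug-in
posterior, with the squared Euclidean norm, as an element of `[0, ∞]`. -/
def expectedSecondMoment {n : ℕ} (αhat : (Fin n → ℝ) → ℝ) (θ₀ : Fin n → ℝ) : ENNReal :=
  ∫⁻ x, ∫⁻ θ, ENNReal.ofReal (∑ i, (θ i - θ₀ i) ^ 2) ∂(posterior (αhat x) x) ∂(law θ₀)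

end

end SpikeSlab

open MeasureTheory ProbabilityTheory

namespace SpikeSlab

/-! ### Densities -/

/-! The Laplace tail of the slab is so light that the likelihood tolerates a weight far above `s /
n`. Put `r = √(log (n/s))` and `α = (s/n) e^r = e^{-T²/2}`, so that `T` is close to `√2 r`. The
marginal log-likelihood is concave in the weight, so a positive score at `α` forces every maximiser
to be at least `α` (`le_of_isMMLE_of_score_pos`).

Under the null the score of one coordinate has mean at least `-δ` and second moment at most `2δ/α`,
with `δ` of order `e^{-9T/10}` (`exists_scoreTerm_moment_bounds`). Each very large mean contributes
at least `1/(2α)`. The `s` signals thus dominate mean and fluctuations of the null part as soon as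
`nαδ = s e^r δ` is a small multiple of `s`. This holds for large `r`, because `(9/10)√2 > 1`.
Chebyshev's inequality then makes the score positive with probability at least `1/2`
(`law_score_nonpos_le`).

On that event each null coordinate with a moderate observation has posterior second moment at least
a constant times `α`. Summing over at least `n/2` null coordinates gives the order `nα = s e^r`
(`le_expectedSecondMoment`). The comparison with the minimax rate holds since `e^r` outgrows every
multiple of `r²`. -/

lemma phi_eq (x : ℝ) : phi x = (Real.sqrt (2 * Real.pi))⁻¹ * Real.exp (-(x ^ 2 / 2)) := by
  simp [phi, gaussianPDFReal_def, neg_div]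

lemma phi_pos (x : ℝ) : 0 < phi x := gaussianPDFReal_pos 0 1 x one_ne_zero

@[fun_prop]
lemma measurable_phi : Measurable phi := measurable_gaussianPDFReal 0 1

lemma integrable_phi : Integrable phi := integrable_gaussianPDFReal 0 1

lemma integral_phi : ∫ x, phi x = 1 := integral_gaussianPDFReal_eq_one 0 one_ne_zero

lemma one_le_sqrt_two_pi : 1 ≤ Real.sqrt (2 * Real.pi) :=
  Real.one_le_sqrt.2 (by linarith [Real.pi_gt_three])

lemma sqrt_two_pi_le_three : Real.sqrt (2 * Real.pi) ≤ 3 :=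
  Real.sqrt_le_iff.2 ⟨by norm_num, by linarith [Real.pi_lt_d2]⟩

lemma phi_le_exp (x : ℝ) : phi x ≤ Real.exp (-(x ^ 2 / 2)) := by
  rw [phi_eq]
  exact mul_le_of_le_one_left (Real.exp_pos _).le (inv_le_one_of_one_le₀ one_le_sqrt_two_pi)

lemma exp_le_three_mul_phi (x : ℝ) : Real.exp (-(x ^ 2 / 2)) ≤ 3 * phi x := by
  have h : (1 : ℝ) ≤ 3 * (Real.sqrt (2 * Real.pi))⁻¹ := by
    rw [← div_eq_mul_inv, one_le_div (by linarith [one_le_sqrt_two_pi])]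
    exact sqrt_two_pi_le_three
  rw [phi_eq, ← mul_assoc]
  exact le_mul_of_one_le_left (Real.exp_pos _).le h

lemma phi_le_one (x : ℝ) : phi x ≤ 1 :=
  (phi_le_exp x).trans (Real.exp_le_one_iff.2 (by nlinarith [sq_nonneg x]))

lemma laplaceDensity_pos (u : ℝ) : 0 < laplaceDensity u := by
  unfold laplaceDensity; positivity

@[fun_prop]
lemma measurable_laplaceDensity : Measurable laplaceDensity := by
  unfold laplaceDensity; fun_prop

lemma integrable_exp_neg_mul_abs {c : ℝ} (hc : 0 < c) :
    Integrable fun x : ℝ => Real.exp (-c * |x|) := by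
  rw [← integrableOn_univ, ← Set.Iic_union_Ioi (a := (0 : ℝ))]
  refine IntegrableOn.union ?_ ?_
  · refine (integrableOn_exp_mul_Iic hc 0).congr_fun (fun x hx => ?_) measurableSet_Iic
    simp [abs_of_nonpos (Set.mem_Iic.1 hx)]
  · refine (integrableOn_exp_mul_Ioi (neg_lt_zero.2 hc) 0).congr_fun (fun x hx => ?_)
      measurableSet_Ioi
    simp [abs_of_pos (Set.mem_Ioi.1 hx)]

lemma integrable_exp_neg_abs : Integrable fun x : ℝ => Real.exp (-|x|) := by
  simpa using integrable_exp_neg_mul_abs one_pos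

lemma integral_exp_neg_abs : ∫ x : ℝ, Real.exp (-|x|) = 2 := by
  rw [integral_comp_abs (f := fun x => Real.exp (-x)), integral_exp_neg_Ioi_zero, mul_one]

lemma integrable_laplaceDensity : Integrable laplaceDensity :=
  integrable_exp_neg_abs.div_const 2

instance : IsProbabilityMeasure slab := by
  refine ⟨?_⟩
  rw [slab, withDensity_apply _ MeasurableSet.univ, Measure.restrict_univ,
    ← ofReal_integral_eq_lintegral_ofReal integrable_laplaceDensity
      (ae_of_all _ fun u => (laplaceDensity_pos u).le)]
  simp [laplaceDensity, integral_div, integral_exp_neg_abs]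

lemma integrable_phi_sub_slab (x : ℝ) : Integrable (fun u => phi (x - u)) slab := by
  refine (integrable_const (1 : ℝ)).mono'
    (measurable_phi.comp (measurable_const.sub measurable_id)).aestronglyMeasurable (ae_of_all _ fun u => ?_)
  rw [Real.norm_of_nonneg (phi_pos _).le]
  exact phi_le_one _

lemma ofReal_g (x : ℝ) : ENNReal.ofReal (g x) = ∫⁻ u, ENNReal.ofReal (phi (x - u)) ∂slab :=
  ofReal_integral_eq_lintegral_ofReal (integrable_phi_sub_slab x)
    (ae_of_all _ fun _ => (phi_pos _).le)

lemma g_eq_integral (x : ℝ) : g x = ∫ u, phi (x - u) * laplaceDensity u := by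
  rw [g, slab, integral_withDensity_eq_integral_toReal_smul (by fun_prop)
    (ae_of_all _ fun _ => ENNReal.ofReal_lt_top)]
  refine integral_congr_ae (ae_of_all _ fun u => ?_)
  simp [ENNReal.toReal_ofReal (laplaceDensity_pos u).le, mul_comm]

lemma g_nonneg (x : ℝ) : 0 ≤ g x := integral_nonneg fun _ => (phi_pos _).le

lemma g_le_one (x : ℝ) : g x ≤ 1 := by
  calc g x ≤ ∫ _, (1 : ℝ) ∂slab :=
        integral_mono (integrable_phi_sub_slab x) (integrable_const _) fun _ => phi_le_one _
    _ = 1 := by simp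

@[fun_prop]
lemma measurable_g : Measurable g := by
  have h : g = fun x => (∫⁻ u, ENNReal.ofReal (phi (x - u)) ∂slab).toReal := by
    ext x
    rw [← ofReal_g, ENNReal.toReal_ofReal (g_nonneg x)]
  rw [h]
  refine Measurable.ennreal_toReal ?_
  exact Measurable.lintegral_prod_right' (f := fun p : ℝ × ℝ => ENNReal.ofReal (phi (p.1 - p.2)))
    (by fun_prop)

/-- The rate 2 serves `g_le_exp`: one factor `e^{-|x-u|}` turns `e^{-|u|}` into `e^{-|x|}`, the
other remains integrable in `u`. -/
lemma phi_le_exp_neg_two_mul_abs (x : ℝ) : phi x ≤ Real.exp (2 - 2 * |x|) := by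
  refine (phi_le_exp x).trans (Real.exp_le_exp.2 ?_)
  nlinarith [sq_nonneg (|x| - 2), sq_abs x]

lemma integrable_phi_mul_laplaceDensity (x : ℝ) :
    Integrable fun u => phi (x - u) * laplaceDensity u := by
  refine integrable_laplaceDensity.mono' (by fun_prop) (ae_of_all _ fun u => ?_)
  rw [Real.norm_of_nonneg (mul_pos (phi_pos _) (laplaceDensity_pos u)).le]
  exact mul_le_of_le_one_left (laplaceDensity_pos u).le (phi_le_one _)

lemma g_le_exp (x : ℝ) : g x ≤ Real.exp 2 * Real.exp (-|x|) := by
  have hint : Integrable fun u : ℝ => Real.exp (-|x - u|) :=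
    integrable_exp_neg_abs.comp_sub_left x
  calc g x = ∫ u, phi (x - u) * laplaceDensity u := g_eq_integral x
    _ ≤ ∫ u, (Real.exp 2 * Real.exp (-|x|) / 2) * Real.exp (-|x - u|) := by
        refine integral_mono (integrable_phi_mul_laplaceDensity x) (hint.const_mul _) fun u => ?_
        have h1 : |x| ≤ |x - u| + |u| := by simpa using abs_add_le (x - u) u
        calc phi (x - u) * laplaceDensity u
            ≤ Real.exp (2 - 2 * |x - u|) * laplaceDensity u :=
              mul_le_mul_of_nonneg_right (phi_le_exp_neg_two_mul_abs _) (laplaceDensity_pos u).le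
          _ = Real.exp (2 - 2 * |x - u| - |u|) / 2 := by
              rw [laplaceDensity, sub_eq_add_neg _ |u|, Real.exp_add]; ring
          _ ≤ Real.exp (2 + -|x| + -|x - u|) / 2 := by gcongr; linarith
          _ = _ := by rw [Real.exp_add, Real.exp_add]; ring
    _ = Real.exp 2 * Real.exp (-|x|) := by
        rw [integral_const_mul, integral_sub_left_eq_self (fun y => Real.exp (-|y|)) volume x,
          integral_exp_neg_abs]
        ring

lemma exp_le_g (x : ℝ) : Real.exp (-2) / 6 * Real.exp (-|x|) ≤ g x := by
  rw [g_eq_integral]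
  calc Real.exp (-2) / 6 * Real.exp (-|x|)
      = ∫ _ in Set.Icc x (x + 1), Real.exp (-2) / 6 * Real.exp (-|x|) := by simp
    _ ≤ ∫ u in Set.Icc x (x + 1), phi (x - u) * laplaceDensity u := by
        refine setIntegral_mono_on (integrable_const _) (integrable_phi_mul_laplaceDensity x).integrableOn
          measurableSet_Icc fun u hu => ?_
        have h1 : Real.exp (-1) / 3 ≤ phi (x - u) := by
          have h := exp_le_three_mul_phi (x - u)
          have : Real.exp (-1) ≤ Real.exp (-((x - u) ^ 2 / 2)) :=
            Real.exp_le_exp.2 (by nlinarith [hu.1, hu.2])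
          linarith
        have h2 : Real.exp (-1) * Real.exp (-|x|) / 2 ≤ laplaceDensity u := by
          rw [laplaceDensity, ← Real.exp_add]
          have : |u| ≤ |u - x| + |x| := by simpa using abs_add_le (u - x) x
          have h3 : |u - x| ≤ 1 := abs_le.2 ⟨by linarith [hu.1], by linarith [hu.2]⟩
          gcongr
          linarith
        calc Real.exp (-2) / 6 * Real.exp (-|x|)
            = Real.exp (-1) / 3 * (Real.exp (-1) * Real.exp (-|x|) / 2) := by
              rw [show (-2 : ℝ) = -1 + -1 by norm_num, Real.exp_add]; ring
          _ ≤ _ := mul_le_mul h1 h2 (by positivity) (phi_pos _).le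
    _ ≤ ∫ u, phi (x - u) * laplaceDensity u :=
        setIntegral_le_integral (integrable_phi_mul_laplaceDensity x)
          (ae_of_all _ fun u => (mul_pos (phi_pos _) (laplaceDensity_pos u)).le)

lemma g_pos (x : ℝ) : 0 < g x := lt_of_lt_of_le (by positivity) (exp_le_g x)

lemma integrable_g : Integrable g := by
  refine (integrable_exp_neg_abs.const_mul (Real.exp 2)).mono' (by fun_prop)
    (ae_of_all _ fun x => ?_)
  rw [Real.norm_of_nonneg (g_nonneg x)]
  exact g_le_exp x

lemma integral_g : ∫ x, g x = 1 := by
  have h : ∫⁻ x, ENNReal.ofReal (g x) = 1 := by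
    simp_rw [ofReal_g]
    rw [lintegral_lintegral_swap (by fun_prop)]
    have : ∀ u : ℝ, ∫⁻ x, ENNReal.ofReal (phi (x - u)) = 1 := fun u => by
      rw [lintegral_sub_right_eq_self (fun y => ENNReal.ofReal (phi y)) u]
      exact lintegral_gaussianPDFReal_eq_one 0 one_ne_zero
    simp [this]
  rw [integral_eq_lintegral_of_nonneg_ae (ae_of_all _ g_nonneg) (by fun_prop), h]
  simp

/-- The ratio `g / φ` tends to infinity. -/
lemma exists_forall_mul_phi_le_g (C : ℝ) : ∃ B : ℝ, ∀ x, B ≤ x → C * phi x ≤ g x := by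
  obtain ⟨B₀, hB₀⟩ : ∃ B₀ : ℝ, C * 6 * Real.exp 2 ≤ Real.exp B₀ := by
    obtain ⟨k, hk⟩ := exists_nat_ge (C * 6 * Real.exp 2)
    exact ⟨k, hk.trans (by linarith [Real.add_one_le_exp (k : ℝ)])⟩
  -- For `x ≥ 4`, `x - x²/2 ≤ -x`; beyond `B₀` the spare factor `e^x` absorbs the constants.
  refine ⟨max 4 B₀, fun x hx => ?_⟩
  have hx4 : 4 ≤ x := (le_max_left _ _).trans hx
  have hxB : B₀ ≤ x := (le_max_right _ _).trans hx
  refine le_trans ?_ (exp_le_g x)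
  rcases le_total C 0 with hC | hC
  · exact (mul_nonpos_of_nonpos_of_nonneg hC (phi_pos x).le).trans (by positivity)
  calc C * phi x ≤ C * Real.exp (-(x ^ 2 / 2)) := by gcongr; exact phi_le_exp x
    _ = (C * 6 * Real.exp 2) * (Real.exp (-2) / 6 * Real.exp (-(x ^ 2 / 2))) := by
        rw [Real.exp_neg 2]; field_simp
    _ ≤ Real.exp x * (Real.exp (-2) / 6 * Real.exp (-(x ^ 2 / 2))) := by
        gcongr; exact hB₀.trans (Real.exp_le_exp.2 hxB)
    _ = Real.exp (-2) / 6 * Real.exp (x - x ^ 2 / 2) := by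
        rw [sub_eq_add_neg, Real.exp_add]; ring
    _ ≤ Real.exp (-2) / 6 * Real.exp (-|x|) := by
        rw [abs_of_nonneg (by linarith)]
        gcongr
        nlinarith

/-! ### The score of the marginal likelihood -/

lemma marginalDensity_pos {α : ℝ} (h0 : 0 ≤ α) (h1 : α ≤ 1) (x : ℝ) :
    0 < marginalDensity α x := by
  unfold marginalDensity
  rcases h0.eq_or_lt with rfl | h
  · simpa using phi_pos x
  · have := mul_nonneg (sub_nonneg.2 h1) (phi_pos x).le
    have := mul_pos h (g_pos x)
    linarith

lemma marginalDensity_le_one {α : ℝ} (h0 : 0 ≤ α) (h1 : α ≤ 1) (x : ℝ) :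
    marginalDensity α x ≤ 1 := by
  unfold marginalDensity
  nlinarith [phi_le_one x, g_le_one x]

@[fun_prop]
lemma measurable_marginalDensity (α : ℝ) : Measurable (marginalDensity α) := by
  unfold marginalDensity; fun_prop

/-- A weight of at most `1/2` leaves half of the null density in the mixture. This bounds the score
from below and allows `φ` to be traded for the marginal density. -/
lemma phi_le_two_mul_marginalDensity {α : ℝ} (h0 : 0 ≤ α) (h1 : α ≤ 1 / 2) (x : ℝ) :
    phi x ≤ 2 * marginalDensity α x := by
  unfold marginalDensity
  nlinarith [phi_pos x, g_pos x, mul_nonneg h0 (g_nonneg x),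
    mul_nonneg (sub_nonneg.2 h1) (phi_pos x).le]

lemma mul_g_le_marginalDensity {α : ℝ} (h1 : α ≤ 1) (x : ℝ) :
    α * g x ≤ marginalDensity α x := by
  unfold marginalDensity
  nlinarith [phi_pos x, mul_nonneg (sub_nonneg.2 h1) (phi_pos x).le]

/-- The derivative in `α` of the log-marginal density of one observation. -/
noncomputable def scoreTerm (α x : ℝ) : ℝ := (g x - phi x) / marginalDensity α x

/-- The integrand of the mean deficit of the score under the null. -/
noncomputable def scoreDeficit (α x : ℝ) : ℝ := α * (g x - phi x) ^ 2 / marginalDensity α x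

@[fun_prop]
lemma measurable_scoreTerm (α : ℝ) : Measurable (scoreTerm α) := by
  unfold scoreTerm; fun_prop

@[fun_prop]
lemma measurable_scoreDeficit (α : ℝ) : Measurable (scoreDeficit α) := by
  unfold scoreDeficit; fun_prop

lemma scoreTerm_le {α : ℝ} (h0 : 0 < α) (h1 : α ≤ 1) (x : ℝ) : scoreTerm α x ≤ 1 / α := by
  rw [scoreTerm, div_le_div_iff₀ (marginalDensity_pos h0.le h1 x) h0]
  nlinarith [mul_g_le_marginalDensity h1 x, mul_pos h0 (phi_pos x)]

lemma neg_two_le_scoreTerm {α : ℝ} (h0 : 0 ≤ α) (h1 : α ≤ 1 / 2) (x : ℝ) :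
    -2 ≤ scoreTerm α x := by
  rw [scoreTerm, le_div_iff₀ (marginalDensity_pos h0 (by linarith) x)]
  linarith [phi_le_two_mul_marginalDensity h0 h1 x, g_pos x]

lemma memLp_scoreTerm {α : ℝ} (h0 : 0 < α) (h1 : α ≤ 1 / 2) (μ : Measure ℝ)
    [IsProbabilityMeasure μ] : MemLp (scoreTerm α) 2 μ :=
  memLp_of_bounded (a := -2) (b := 1 / α)
    (ae_of_all _ fun x => ⟨neg_two_le_scoreTerm h0.le h1 x, scoreTerm_le h0 (by linarith) x⟩)
    (measurable_scoreTerm α).aestronglyMeasurable 2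

lemma scoreDeficit_nonneg {α : ℝ} (h0 : 0 ≤ α) (h1 : α ≤ 1) (x : ℝ) : 0 ≤ scoreDeficit α x :=
  div_nonneg (mul_nonneg h0 (sq_nonneg _)) (marginalDensity_pos h0 h1 x).le

/-- Since `g` and `φ` both integrate to 1, the null mean of the score is minus the integral of the
deficit. -/
lemma phi_mul_scoreTerm {α : ℝ} (h0 : 0 ≤ α) (h1 : α ≤ 1) (x : ℝ) :
    phi x * scoreTerm α x = g x - phi x - scoreDeficit α x := by
  have h := (marginalDensity_pos h0 h1 x).ne'
  unfold scoreTerm scoreDeficit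
  field_simp
  unfold marginalDensity
  ring

/-- Replacing `φ` by twice the marginal density reproduces the deficit, so a single integral
controls both null moments. -/
lemma phi_mul_scoreTerm_sq_le {α : ℝ} (h0 : 0 < α) (h1 : α ≤ 1 / 2) (x : ℝ) :
    phi x * scoreTerm α x ^ 2 ≤ 2 / α * scoreDeficit α x := by
  have hm := marginalDensity_pos h0.le (by linarith) x
  have h : 2 / α * scoreDeficit α x - phi x * scoreTerm α x ^ 2 =
      (2 * marginalDensity α x - phi x) * scoreTerm α x ^ 2 := by
    unfold scoreTerm scoreDeficit
    field_simp
  have := mul_nonneg (sub_nonneg.2 (phi_le_two_mul_marginalDensity h0.le h1 x))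
    (sq_nonneg (scoreTerm α x))
  linarith

lemma scoreDeficit_le_g_add {α : ℝ} (h0 : 0 ≤ α) (h1 : α ≤ 1 / 2) (x : ℝ) :
    scoreDeficit α x ≤ 2 * α * phi x + g x := by
  have hp := phi_pos x
  have hg := g_pos x
  have hm := phi_le_two_mul_marginalDensity h0 h1 x
  have hm' := mul_g_le_marginalDensity (by linarith : α ≤ 1) x
  rw [scoreDeficit, div_le_iff₀ (marginalDensity_pos h0 (by linarith) x)]
  have e1 : α * phi x * phi x ≤ α * phi x * (2 * marginalDensity α x) := by gcongr
  have e2 : g x * (α * g x) ≤ g x * marginalDensity α x := by gcongr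
  nlinarith [mul_nonneg h0 (mul_pos hp hg).le]

lemma scoreDeficit_le_sq_div_add {α : ℝ} (h0 : 0 ≤ α) (h1 : α ≤ 1 / 2) (x : ℝ) :
    scoreDeficit α x ≤ 2 * α * phi x + 2 * α * (g x ^ 2 / phi x) := by
  have hp := phi_pos x
  have hg := g_pos x
  have hm := phi_le_two_mul_marginalDensity h0 h1 x
  calc scoreDeficit α x ≤ α * (g x - phi x) ^ 2 / (phi x / 2) := by
        unfold scoreDeficit
        gcongr
        linarith
    _ ≤ α * (g x ^ 2 + phi x ^ 2) / (phi x / 2) := by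
        gcongr
        nlinarith [mul_pos hp hg]
    _ = _ := by field_simp; ring

lemma scoreDeficit_le {T : ℝ} (hT : 2 ≤ T) (x : ℝ) :
    scoreDeficit (Real.exp (-(T ^ 2 / 2))) x ≤ 2 * Real.exp (-(T ^ 2 / 2)) * phi x +
      6 * Real.exp 4 * Real.exp (-(9 / 10 * T)) * Real.exp (-(1 / 10) * |x|) := by
  set α := Real.exp (-(T ^ 2 / 2)) with hα
  have h0 : 0 < α := Real.exp_pos _
  have h1 : α ≤ 1 / 2 := by
    rw [hα, Real.exp_neg, one_div]
    exact inv_anti₀ two_pos (by nlinarith [Real.add_one_le_exp (T ^ 2 / 2)])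
  -- `T` is where `α e^{x²/2} = 1`. Inside, `φ` bounds the denominator; outside, `α g` does.
  rcases le_total |x| T with hx | hx
  · refine (scoreDeficit_le_sq_div_add h0.le h1 x).trans (add_le_add le_rfl ?_)
    have hg : g x ^ 2 ≤ Real.exp 4 * Real.exp (-(2 * |x|)) := by
      calc g x ^ 2 ≤ (Real.exp 2 * Real.exp (-|x|)) ^ 2 := by
            gcongr
            · exact g_nonneg x
            · exact g_le_exp x
        _ = _ := by rw [mul_pow, ← Real.exp_nat_mul, ← Real.exp_nat_mul]; norm_num
    have hd : g x ^ 2 / phi x ≤ 3 * Real.exp 4 * Real.exp (-(2 * |x|)) * Real.exp (x ^ 2 / 2) := by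
      rw [div_le_iff₀ (phi_pos x)]
      have hE : 1 ≤ Real.exp (x ^ 2 / 2) * (3 * phi x) := by
        calc 1 = Real.exp (x ^ 2 / 2) * Real.exp (-(x ^ 2 / 2)) := by
              rw [← Real.exp_add]; simp
          _ ≤ _ := by gcongr; exact exp_le_three_mul_phi x
      calc g x ^ 2 ≤ Real.exp 4 * Real.exp (-(2 * |x|)) := hg
        _ ≤ Real.exp 4 * Real.exp (-(2 * |x|)) * (Real.exp (x ^ 2 / 2) * (3 * phi x)) :=
            le_mul_of_one_le_right (by positivity) hE
        _ = _ := by ring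
    calc 2 * α * (g x ^ 2 / phi x)
        ≤ 2 * α * (3 * Real.exp 4 * Real.exp (-(2 * |x|)) * Real.exp (x ^ 2 / 2)) := by gcongr
      _ = 6 * Real.exp 4 * Real.exp (-(T ^ 2 / 2) + -(2 * |x|) + x ^ 2 / 2) := by
          rw [hα, Real.exp_add, Real.exp_add]; ring
      _ ≤ 6 * Real.exp 4 * Real.exp (-(9 / 10 * T) + -(1 / 10) * |x|) := by
          refine mul_le_mul_of_nonneg_left (Real.exp_le_exp.2 ?_) (by positivity)
          rw [← sq_abs x]
          -- `(T - |x|)(T + |x| - 2) ≥ 0` gives `(x² - T²)/2 ≤ |x| - T`, so the exponent is at most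
          -- `-T - |x|`. A tenth of the decay is kept in `x` for integrability.
          nlinarith [abs_nonneg x, mul_nonneg (sub_nonneg.2 hx) (by linarith [abs_nonneg x] :
            0 ≤ T + |x| - 2)]
      _ = _ := by rw [Real.exp_add]; ring
  · refine (scoreDeficit_le_g_add h0.le h1 x).trans (add_le_add le_rfl ?_)
    calc g x ≤ Real.exp 2 * Real.exp (-|x|) := g_le_exp x
      _ ≤ 6 * Real.exp 4 * Real.exp (-(9 / 10 * T) + -(1 / 10) * |x|) := by
          gcongr
          · have : Real.exp 2 ≤ Real.exp 4 := Real.exp_le_exp.2 (by norm_num)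
            linarith [Real.exp_pos 4]
          · linarith
      _ = _ := by rw [Real.exp_add]; ring

/-- Under the null the score at `α = exp (-T² / 2)` has mean at least `-C exp (-9T/10)` and second
moment at most `2 C exp (-9T/10) / α`. -/
lemma exists_scoreTerm_moment_bounds : ∃ C : ℝ, 0 < C ∧ ∀ T : ℝ, 2 ≤ T →
    -(C * Real.exp (-(9 / 10 * T))) ≤
        ∫ x, scoreTerm (Real.exp (-(T ^ 2 / 2))) x ∂(gaussianReal 0 1) ∧
      ∫ x, scoreTerm (Real.exp (-(T ^ 2 / 2))) x ^ 2 ∂(gaussianReal 0 1) ≤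
        2 / Real.exp (-(T ^ 2 / 2)) * (C * Real.exp (-(9 / 10 * T))) := by
  set J := ∫ x : ℝ, Real.exp (-(1 / 10) * |x|)
  have hJ : 0 ≤ J := integral_nonneg fun _ => (Real.exp_pos _).le
  refine ⟨2 + 6 * Real.exp 4 * J, by positivity, fun T hT => ?_⟩
  have hbound := scoreDeficit_le hT
  set α := Real.exp (-(T ^ 2 / 2)) with hα
  have h0 : 0 < α := Real.exp_pos _
  have h1 : α ≤ 1 / 2 := by
    rw [hα, Real.exp_neg, one_div]
    exact inv_anti₀ two_pos (by nlinarith [Real.add_one_le_exp (T ^ 2 / 2)])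
  have hJint := integrable_exp_neg_mul_abs (by norm_num : (0 : ℝ) < 1 / 10)
  have hdom := (integrable_phi.const_mul (2 * α)).add
    (hJint.const_mul (6 * Real.exp 4 * Real.exp (-(9 / 10 * T))))
  have hint : Integrable (scoreDeficit α) := by
    refine hdom.mono' (by fun_prop) (ae_of_all _ fun x => ?_)
    rw [Real.norm_of_nonneg (scoreDeficit_nonneg h0.le (by linarith) x)]
    exact hbound x
  have hle : ∫ x, scoreDeficit α x ≤ (2 + 6 * Real.exp 4 * J) * Real.exp (-(9 / 10 * T)) := by
    have h2 : ∫ x, scoreDeficit α x ≤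
        2 * α + 6 * Real.exp 4 * Real.exp (-(9 / 10 * T)) * J := by
      refine (integral_mono hint hdom hbound).trans_eq ?_
      simp only [Pi.add_apply]
      rw [integral_add (integrable_phi.const_mul _) (hJint.const_mul _), integral_const_mul,
        integral_const_mul, integral_phi, mul_one]
    have h3 : α ≤ Real.exp (-(9 / 10 * T)) := Real.exp_le_exp.2 (by nlinarith)
    linarith
  constructor
  · rw [integral_gaussianReal_eq_integral_smul one_ne_zero]
    calc -((2 + 6 * Real.exp 4 * J) * Real.exp (-(9 / 10 * T)))
        ≤ -∫ x, scoreDeficit α x := neg_le_neg hle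
      _ = ∫ x, (g x - phi x - scoreDeficit α x) := by
          have h : Integrable fun x => g x - phi x := integrable_g.sub integrable_phi
          rw [integral_sub h hint, integral_sub integrable_g integrable_phi, integral_g, integral_phi]
          ring
      _ = _ := integral_congr_ae (ae_of_all _ fun x =>
          (phi_mul_scoreTerm h0.le (by linarith) x).symm)
  · rw [integral_gaussianReal_eq_integral_smul one_ne_zero]
    calc ∫ x, phi x * scoreTerm α x ^ 2 ≤ ∫ x, 2 / α * scoreDeficit α x := by
          refine integral_mono_of_nonneg (ae_of_all _ fun x => ?_) (hint.const_mul _)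
            (ae_of_all _ fun x => phi_mul_scoreTerm_sq_le h0 h1 x)
          exact mul_nonneg (phi_pos x).le (sq_nonneg _)
      _ ≤ _ := by
          rw [integral_const_mul]
          gcongr

/-- A positive score at `α` forces the maximiser to be at least `α`. -/
lemma le_of_isMMLE_of_score_pos {n : ℕ} {x : Fin n → ℝ} {α a : ℝ} (h1 : α ≤ 1)
    (hs : 0 < ∑ i, scoreTerm α (x i)) (ha : IsMMLE x a) : α ≤ a := by
  by_contra! hlt
  obtain ⟨⟨hl, hu⟩, hmax⟩ := ha
  -- Nonnegativity is all that is needed of the end point; it would hold even for an empty defining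
  -- set, where `sInf` is 0.
  have hlow : 0 ≤ alphaLower n := Real.sInf_nonneg fun y hy => hy.1.1.le
  have ha0 : 0 ≤ a := hlow.trans hl
  have hle : logMarginalLikelihood x α ≤ logMarginalLikelihood x a :=
    hmax (show α ∈ Set.Icc (alphaLower n) 1 from ⟨hl.trans hlt.le, h1⟩)
  -- Concavity in tangent-line form, from `log t ≤ t - 1` at the ratio of the two marginal
  -- densities.
  have hterm : ∀ i, (α - a) * scoreTerm α (x i) ≤
      Real.log (marginalDensity α (x i)) - Real.log (marginalDensity a (x i)) := fun i => by
    have hm := marginalDensity_pos (ha0.trans hlt.le) h1 (x i)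
    have hm' := marginalDensity_pos ha0 hu (x i)
    have hlog := Real.log_le_sub_one_of_pos (div_pos hm' hm)
    rw [Real.log_div hm'.ne' hm.ne'] at hlog
    have he : (α - a) * scoreTerm α (x i) =
        1 - marginalDensity a (x i) / marginalDensity α (x i) := by
      unfold scoreTerm
      field_simp
      unfold marginalDensity
      ring
    linarith
  have hsum := Finset.sum_le_sum fun i (_ : i ∈ Finset.univ) => hterm i
  rw [← Finset.mul_sum, Finset.sum_sub_distrib] at hsum
  unfold logMarginalLikelihood at hle
  nlinarith [mul_pos (sub_pos.2 hlt) hs]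

/-! ### The posterior second moment -/

lemma slabWeight_nonneg {α : ℝ} (h0 : 0 ≤ α) (h1 : α ≤ 1) (x : ℝ) : 0 ≤ slabWeight α x :=
  div_nonneg (mul_nonneg h0 (g_nonneg x)) (marginalDensity_pos h0 h1 x).le

lemma slabWeight_le_one {α : ℝ} (h0 : 0 ≤ α) (h1 : α ≤ 1) (x : ℝ) : slabWeight α x ≤ 1 :=
  div_le_one_of_le₀ (mul_g_le_marginalDensity h1 x) (marginalDensity_pos h0 h1 x).le

lemma mul_g_le_slabWeight {α : ℝ} (h0 : 0 ≤ α) (h1 : α ≤ 1) (x : ℝ) :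
    α * g x ≤ slabWeight α x := by
  rw [slabWeight, le_div_iff₀ (marginalDensity_pos h0 h1 x)]
  exact mul_le_of_le_one_right (mul_nonneg h0 (g_nonneg x)) (marginalDensity_le_one h0 h1 x)

instance (x : ℝ) : IsProbabilityMeasure (slabPosterior x) := by
  refine ⟨?_⟩
  rw [slabPosterior, withDensity_apply _ MeasurableSet.univ, Measure.restrict_univ,
    ← ofReal_integral_eq_lintegral_ofReal ((integrable_phi_mul_laplaceDensity x).div_const _)
      (ae_of_all _ fun u => div_nonneg (mul_pos (phi_pos _) (laplaceDensity_pos u)).le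
        (g_nonneg x)),
    integral_div, ← g_eq_integral, div_self (g_pos x).ne', ENNReal.ofReal_one]

lemma isProbabilityMeasure_coordPosterior {α : ℝ} (h0 : 0 ≤ α) (h1 : α ≤ 1) (x : ℝ) :
    IsProbabilityMeasure (coordPosterior α x) := by
  refine ⟨?_⟩
  simp only [coordPosterior, Measure.coe_add, Measure.coe_smul, Pi.add_apply, Pi.smul_apply,
    measure_univ, smul_eq_mul, mul_one]
  rw [← ENNReal.ofReal_add (sub_nonneg.2 (slabWeight_le_one h0 h1 x)) (slabWeight_nonneg h0 h1 x)]
  simp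

/-- Only `u` in `[1, 2]` is used: there `|x - u| ≤ 4` gives `φ ≥ e^{-8}/3`, and the Laplace density
is at least `e^{-2}/2`. The factor `1 / g x` is kept to cancel against `mul_g_le_slabWeight`. -/
lemma le_lintegral_sq_slabPosterior {x : ℝ} (hx : |x| ≤ 2) :
    ENNReal.ofReal (Real.exp (-10) / 6 / g x) ≤
      ∫⁻ u, ENNReal.ofReal (u ^ 2) ∂(slabPosterior x) := by
  rw [slabPosterior, lintegral_withDensity_eq_lintegral_mul _ (by fun_prop) (by fun_prop)]
  calc ENNReal.ofReal (Real.exp (-10) / 6 / g x)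
      = ∫⁻ _ in Set.Icc (1 : ℝ) 2, ENNReal.ofReal (Real.exp (-10) / 6 / g x) := by
        rw [setLIntegral_const, Real.volume_Icc]; norm_num
    _ ≤ ∫⁻ u in Set.Icc (1 : ℝ) 2,
          ENNReal.ofReal (phi (x - u) * laplaceDensity u / g x) * ENNReal.ofReal (u ^ 2) := by
        refine setLIntegral_mono' measurableSet_Icc fun u hu => ?_
        rw [← ENNReal.ofReal_mul (div_nonneg (mul_pos (phi_pos _) (laplaceDensity_pos u)).le
          (g_nonneg x))]
        refine ENNReal.ofReal_le_ofReal ?_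
        obtain ⟨hx1, hx2⟩ := abs_le.1 hx
        have hphi : Real.exp (-8) / 3 ≤ phi (x - u) := by
          have h : Real.exp (-8) ≤ Real.exp (-((x - u) ^ 2 / 2)) :=
            Real.exp_le_exp.2 (by nlinarith [hu.1, hu.2])
          linarith [exp_le_three_mul_phi (x - u)]
        have hlap : Real.exp (-2) / 2 ≤ laplaceDensity u := by
          rw [laplaceDensity, abs_of_nonneg (by linarith [hu.1])]
          gcongr
          linarith [hu.2]
        have hmul : Real.exp (-10) / 6 ≤ phi (x - u) * laplaceDensity u := by
          calc Real.exp (-10) / 6 = Real.exp (-8) / 3 * (Real.exp (-2) / 2) := by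
                rw [show (-10 : ℝ) = -8 + -2 by norm_num, Real.exp_add]; ring
            _ ≤ _ := mul_le_mul hphi hlap (by positivity) (phi_pos _).le
        have hg := g_pos x
        calc Real.exp (-10) / 6 / g x ≤ phi (x - u) * laplaceDensity u / g x := by gcongr
          _ ≤ _ := le_mul_of_one_le_right
              (div_nonneg (mul_pos (phi_pos _) (laplaceDensity_pos u)).le hg.le)
              (by nlinarith [hu.1])
    _ ≤ _ := setLIntegral_le_lintegral _ _

lemma le_lintegral_sq_coordPosterior {α x : ℝ} (h0 : 0 ≤ α) (h1 : α ≤ 1) (hx : |x| ≤ 2) :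
    ENNReal.ofReal (Real.exp (-10) / 6 * α) ≤
      ∫⁻ u, ENNReal.ofReal (u ^ 2) ∂(coordPosterior α x) := by
  have hg := g_pos x
  calc ENNReal.ofReal (Real.exp (-10) / 6 * α)
      = ENNReal.ofReal (α * g x) * ENNReal.ofReal (Real.exp (-10) / 6 / g x) := by
        rw [← ENNReal.ofReal_mul (by positivity)]
        congr 1
        field_simp
    _ ≤ ENNReal.ofReal (slabWeight α x) * ∫⁻ u, ENNReal.ofReal (u ^ 2) ∂(slabPosterior x) := by
        gcongr
        · exact mul_g_le_slabWeight h0 h1 x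
        · exact le_lintegral_sq_slabPosterior hx
    _ ≤ _ := by
        rw [coordPosterior, lintegral_add_measure, lintegral_smul_measure, lintegral_smul_measure,
          smul_eq_mul, smul_eq_mul]
        exact le_add_self

/-- Coordinates outside `N` are dropped; on `N` the error is `θ i ^ 2`, whose integral depends only
on the marginal of the product. -/
lemma sum_lintegral_sq_le_lintegral_posterior {n : ℕ} {α : ℝ} (h0 : 0 ≤ α) (h1 : α ≤ 1)
    (x θ₀ : Fin n → ℝ) (N : Finset (Fin n)) (hN : ∀ i ∈ N, θ₀ i = 0) :
    ∑ i ∈ N, ∫⁻ u, ENNReal.ofReal (u ^ 2) ∂(coordPosterior α (x i)) ≤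
      ∫⁻ θ, ENNReal.ofReal (∑ i, (θ i - θ₀ i) ^ 2) ∂(posterior α x) := by
  have hp : ∀ i, IsProbabilityMeasure (coordPosterior α (x i)) := fun i =>
    isProbabilityMeasure_coordPosterior h0 h1 (x i)
  have hi : ∀ i, ∫⁻ u, ENNReal.ofReal (u ^ 2) ∂(coordPosterior α (x i)) =
      ∫⁻ θ, ENNReal.ofReal (θ i ^ 2) ∂(posterior α x) := fun i =>
    ((measurePreserving_eval (fun i => coordPosterior α (x i)) i).lintegral_comp
      (f := fun u : ℝ => ENNReal.ofReal (u ^ 2)) (by fun_prop)).symm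
  simp_rw [hi]
  rw [← lintegral_finsetSum _ fun i _ => by fun_prop]
  refine lintegral_mono fun θ => ?_
  rw [← ENNReal.ofReal_sum_of_nonneg fun i _ => sq_nonneg _]
  refine ENNReal.ofReal_le_ofReal ?_
  calc ∑ i ∈ N, θ i ^ 2 = ∑ i ∈ N, (θ i - θ₀ i) ^ 2 :=
        Finset.sum_congr rfl fun i hi => by rw [hN i hi, sub_zero]
    _ ≤ _ := Finset.sum_le_sum_of_subset_of_nonneg (Finset.subset_univ _) fun _ _ _ => sq_nonneg _

instance {n : ℕ} (θ : Fin n → ℝ) : IsProbabilityMeasure (law θ) := by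
  unfold law; infer_instance

lemma measurePreserving_eval_law {n : ℕ} (θ : Fin n → ℝ) (i : Fin n) :
    MeasurePreserving (Function.eval i) (law θ) (gaussianReal (θ i) 1) :=
  measurePreserving_eval (fun i => gaussianReal (θ i) 1) i

lemma gaussianReal_tail_le (m : ℝ) {r : ℝ} (hr : 0 < r) :
    gaussianReal m 1 {x | r ≤ |x - m|} ≤ ENNReal.ofReal (1 / r ^ 2) := by
  have h := meas_ge_le_variance_div_sq (memLp_id_gaussianReal (μ := m) (v := 1) 2) hr
  simpa [integral_id_gaussianReal, variance_id_gaussianReal] using h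

lemma law_tail_le {n : ℕ} (θ : Fin n → ℝ) (i : Fin n) {r : ℝ} (hr : 0 < r) :
    law θ {x | r ≤ |x i - θ i|} ≤ ENNReal.ofReal (1 / r ^ 2) := by
  refine le_trans (le_of_eq ?_) (gaussianReal_tail_le (θ i) hr)
  exact (measurePreserving_eval_law θ i).measure_preimage
    (s := {x : ℝ | r ≤ |x - θ i|})
    (measurableSet_le measurable_const (by fun_prop)).nullMeasurableSet

/-- If the maximiser is at least `α` with probability at least `1/2`, then the expected posterior
second moment is at least of the order of `α` times the number of vanishing means. -/
lemma le_expectedSecondMoment {n : ℕ} {α : ℝ} (h0 : 0 ≤ α) (θ₀ : Fin n → ℝ)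
    (N : Finset (Fin n)) (hN : ∀ i ∈ N, θ₀ i = 0) {A : Set (Fin n → ℝ)} (hA : MeasurableSet A)
    (hPA : law θ₀ Aᶜ ≤ 1 / 2) {αhat : (Fin n → ℝ) → ℝ} (hhat : ∀ x, αhat x ≤ 1)
    (hle : ∀ x ∈ A, α ≤ αhat x) :
    ENNReal.ofReal (N.card * (Real.exp (-10) / 24 * α)) ≤ expectedSecondMoment αhat θ₀ := by
  set c : ENNReal := ENNReal.ofReal (Real.exp (-10) / 6 * α) with hc
  have hBm : ∀ i : Fin n, MeasurableSet {x : Fin n → ℝ | |x i| ≤ 2} := fun i =>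
    measurableSet_le (by fun_prop) measurable_const
  have hprob : ∀ i ∈ N, 1 / 4 ≤ law θ₀ (A ∩ {x | |x i| ≤ 2}) := fun i hi => by
    have htail : law θ₀ {x | |x i| ≤ 2}ᶜ ≤ 1 / 4 := by
      refine le_trans (measure_mono fun x hx => ?_)
        ((law_tail_le θ₀ i two_pos).trans (le_of_eq ?_))
      · simp only [Set.mem_compl_iff, Set.mem_ofPred_eq, not_le] at hx
        simpa [hN i hi] using hx.le
      · rw [ENNReal.ofReal_div_of_pos (by norm_num)]; norm_num
    have hcompl : law θ₀ (A ∩ {x | |x i| ≤ 2})ᶜ ≤ 1 / 2 + 1 / 4 := by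
      rw [Set.compl_inter]
      exact (measure_union_le _ _).trans (add_le_add hPA htail)
    have hone := prob_add_prob_compl (μ := law θ₀) (hA.inter (hBm i))
    have hreal : (1 / 2 + 1 / 4 : ENNReal) = ENNReal.ofReal (3 / 4) := by
      rw [show (3 / 4 : ℝ) = 1 / 2 + 1 / 4 by norm_num,
        ENNReal.ofReal_add (by norm_num) (by norm_num),
        ENNReal.ofReal_div_of_pos (by norm_num), ENNReal.ofReal_div_of_pos (by norm_num)]
      norm_num
    have hq : (1 / 4 : ENNReal) = ENNReal.ofReal (1 / 4) := by
      rw [ENNReal.ofReal_div_of_pos (by norm_num)]; norm_num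
    rw [hreal] at hcompl
    rw [hq]
    have h1 : ENNReal.ofReal (1 / 4) + ENNReal.ofReal (3 / 4) ≤
        law θ₀ (A ∩ {x | |x i| ≤ 2}) + ENNReal.ofReal (3 / 4) := by
      rw [← ENNReal.ofReal_add (by norm_num) (by norm_num)]
      calc ENNReal.ofReal (1 / 4 + 3 / 4) = 1 := by norm_num
        _ = _ := hone.symm
        _ ≤ _ := by gcongr
    exact (ENNReal.add_le_add_iff_right ENNReal.ofReal_ne_top).1 h1
  calc ENNReal.ofReal (N.card * (Real.exp (-10) / 24 * α)) = ∑ _i ∈ N, c * (1 / 4) := by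
        rw [Finset.sum_const, nsmul_eq_mul, hc, ENNReal.ofReal_mul (by positivity),
          ENNReal.ofReal_natCast]
        congr 1
        rw [show Real.exp (-10) / 24 * α = Real.exp (-10) / 6 * α * (1 / 4) by ring,
          ENNReal.ofReal_mul (by positivity), ENNReal.ofReal_div_of_pos (by norm_num)]
        norm_num
    _ ≤ ∑ i ∈ N, c * law θ₀ (A ∩ {x | |x i| ≤ 2}) :=
        Finset.sum_le_sum fun i hi => by gcongr; exact hprob i hi
    _ = ∫⁻ x, ∑ i ∈ N, (A ∩ {x : Fin n → ℝ | |x i| ≤ 2}).indicator (fun _ => c) x ∂(law θ₀) := by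
        rw [lintegral_finsetSum _ fun i _ => measurable_const.indicator (hA.inter (hBm i))]
        refine Finset.sum_congr rfl fun i _ => ?_
        rw [lintegral_indicator_const (hA.inter (hBm i))]
    _ ≤ _ := by
        refine lintegral_mono fun x => ?_
        -- The comparison is pointwise in `x`, so `αhat` need not be measurable.
        by_cases hx : x ∈ A
        · have hx0 : 0 ≤ αhat x := h0.trans (hle x hx)
          refine le_trans (Finset.sum_le_sum fun i _ => ?_)
            (sum_lintegral_sq_le_lintegral_posterior hx0 (hhat x) x θ₀ N hN)
          refine Set.indicator_apply_le' (fun hxi => ?_) fun _ => zero_le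
          refine le_trans (ENNReal.ofReal_le_ofReal ?_)
            (le_lintegral_sq_coordPosterior hx0 (hhat x) hxi.2)
          gcongr
          exact hle x hx
        · simp [hx]

/-! ### Probability that the score is positive -/

/-- The score cannot exceed `1/α`; an observation far enough out reaches half of this maximum. -/
lemma one_div_le_scoreTerm {α x : ℝ} (h0 : 0 < α) (h1 : α ≤ 1)
    (hx : (1 + 1 / α) * phi x ≤ g x) : 1 / (2 * α) ≤ scoreTerm α x := by
  rw [scoreTerm, div_le_div_iff₀ (by positivity) (marginalDensity_pos h0.le h1 x)]
  have h : (1 + α) * phi x ≤ α * g x := by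
    calc (1 + α) * phi x = α * ((1 + 1 / α) * phi x) := by field_simp; ring
      _ ≤ _ := by gcongr
  unfold marginalDensity
  linarith

/-- The score of the coordinates outside `S`, whose means vanish, is bounded below with probability
at least `3/4`. -/
lemma law_null_score_lt_le {n : ℕ} {s : ℝ} {α δ : ℝ} (hs : 1 ≤ s) (h0 : 0 < α) (h1 : α ≤ 1 / 2)
    (hδ : 0 ≤ δ) (hmean : -δ ≤ ∫ x, scoreTerm α x ∂(gaussianReal 0 1))
    (hsq : ∫ x, scoreTerm α x ^ 2 ∂(gaussianReal 0 1) ≤ 2 / α * δ)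
    (hn : n * α * δ ≤ s / 512) (θ₀ : Fin n → ℝ) (S : Finset (Fin n))
    (hS : ∀ i ∉ S, θ₀ i = 0) :
    law θ₀ {x | ∑ i, (if i ∈ S then 0 else scoreTerm α (x i)) < -(s / (4 * α))} ≤
      ENNReal.ofReal (1 / 4) := by
  -- Setting the signal terms to zero keeps a sum over all coordinates of the product measure, where
  -- variances add.
  set X : Fin n → ℝ → ℝ := fun i => if i ∈ S then 0 else scoreTerm α with hX
  have hXapp : ∀ i y, X i y = if i ∈ S then 0 else scoreTerm α y := fun i y => by
    by_cases h : i ∈ S <;> simp [hX, h]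
  have hmem : ∀ i, MemLp (X i) 2 (gaussianReal (θ₀ i) 1) := fun i => by
    by_cases h : i ∈ S
    · simp [hX, h]
    · simpa [hX, h] using memLp_scoreTerm h0 h1 _
  set Z : (Fin n → ℝ) → ℝ := ∑ i, fun x => X i (x i) with hZ
  have hZapp : ∀ x, Z x = ∑ i, (if i ∈ S then 0 else scoreTerm α (x i)) := fun x => by
    simp only [hZ, Finset.sum_apply, hXapp]
  have hmemc : ∀ i, MemLp (fun x : Fin n → ℝ => X i (x i)) 2 (law θ₀) := fun i =>
    (hmem i).comp_measurePreserving (measurePreserving_eval_law θ₀ i)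
  have hZmem : MemLp Z 2 (law θ₀) := memLp_finsetSum' _ fun i _ => hmemc i
  have hvar : Var[Z; law θ₀] ≤ n * (2 / α * δ) := by
    have h := variance_sum_pi hmem
    change Var[Z; law θ₀] = _ at h
    rw [h]
    have hi : ∀ i, Var[X i; gaussianReal (θ₀ i) 1] ≤ 2 / α * δ := fun i => by
      by_cases hiS : i ∈ S
      · simp only [hX, hiS, if_true, variance_zero]
        positivity
      · simp only [hX, hiS, if_false, hS i hiS]
        exact (variance_le_expectation_sq (by fun_prop)).trans hsq
    calc ∑ i, Var[X i; gaussianReal (θ₀ i) 1] ≤ ∑ _i : Fin n, 2 / α * δ :=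
          Finset.sum_le_sum fun i _ => hi i
      _ = _ := by simp
  have hexp : -(n * δ) ≤ ∫ x, Z x ∂(law θ₀) := by
    have h : ∫ x, Z x ∂(law θ₀) = ∑ i, ∫ y, X i y ∂(gaussianReal (θ₀ i) 1) := by
      simp only [hZ, Finset.sum_apply]
      rw [integral_finsetSum _ fun i _ => (hmemc i).integrable (by norm_num)]
      exact Finset.sum_congr rfl fun i _ => integral_comp_eval (hmem i).aestronglyMeasurable
    have hi : ∀ i, -δ ≤ ∫ y, X i y ∂(gaussianReal (θ₀ i) 1) := fun i => by
      by_cases hiS : i ∈ S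
      · simpa [hX, hiS] using hδ
      · simpa only [hX, hiS, if_false, hS i hiS] using hmean
    rw [h]
    calc -(n * δ) = ∑ _i : Fin n, -δ := by simp
      _ ≤ _ := Finset.sum_le_sum fun i _ => hi i
  -- The allowance `s/(4α)` is split equally between the mean and the fluctuation.
  have hr : 0 < s / (8 * α) := by positivity
  have hnδ : n * δ ≤ s / (8 * α) := by
    rw [le_div_iff₀ (by positivity)]
    linarith
  refine le_trans (measure_mono fun x hx => ?_)
    ((meas_ge_le_variance_div_sq hZmem hr).trans (ENNReal.ofReal_le_ofReal ?_))
  · have hx' : Z x < -(s / (4 * α)) := by rw [hZapp]; exact hx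
    change s / (8 * α) ≤ |Z x - ∫ x, Z x ∂(law θ₀)|
    have he : s / (4 * α) = s / (8 * α) + s / (8 * α) := by field_simp; ring
    refine le_trans ?_ (neg_le_abs _)
    linarith
  · rw [div_le_iff₀ (by positivity)]
    refine hvar.trans ?_
    have he : (n : ℝ) * (2 / α * δ) = n * α * δ * (2 / α ^ 2) := by field_simp
    -- Origin of 512: Chebyshev at level `1/4` needs `nαδ ≤ s²/512`, which follows from `s/512` as
    -- `s ≥ 1`.
    have he' : 1 / 4 * (s / (8 * α)) ^ 2 = s ^ 2 / 512 * (2 / α ^ 2) := by field_simp; norm_num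
    rw [he, he']
    gcongr
    refine hn.trans ?_
    gcongr
    nlinarith

/-- With `s` sufficiently large means, the score at `α` is positive with probability at least
`1/2`. -/
lemma law_score_nonpos_le {n : ℕ} {α δ B : ℝ} (h0 : 0 < α) (h1 : α ≤ 1 / 2) (hδ : 0 ≤ δ)
    (hmean : -δ ≤ ∫ x, scoreTerm α x ∂(gaussianReal 0 1))
    (hsq : ∫ x, scoreTerm α x ^ 2 ∂(gaussianReal 0 1) ≤ 2 / α * δ)
    (hB : ∀ x, B ≤ x → (1 + 1 / α) * phi x ≤ g x)
    (θ₀ : Fin n → ℝ) (S : Finset (Fin n)) (hScard : 1 ≤ S.card)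
    (hn : n * α * δ ≤ S.card / 512) (hS : ∀ i ∉ S, θ₀ i = 0)
    (hS' : ∀ i ∈ S, θ₀ i = B + 2 * Real.sqrt S.card) :
    law θ₀ {x | 0 < ∑ i, scoreTerm α (x i)}ᶜ ≤ 1 / 2 := by
  have hs : (1 : ℝ) ≤ S.card := by exact_mod_cast hScard
  -- Chebyshev gives each signal a failure probability of at most `1/(4|S|)`, so the union bound
  -- costs `1/4`.
  set r := 2 * Real.sqrt S.card with hr
  have hr0 : 0 < r := by positivity
  have hr2 : 1 / r ^ 2 = 1 / 4 / S.card := by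
    rw [hr, mul_pow, Real.sq_sqrt (by positivity)]; field_simp; norm_num
  have hsub : {x : Fin n → ℝ | 0 < ∑ i, scoreTerm α (x i)}ᶜ ⊆
      (⋃ i ∈ S, {x | r ≤ |x i - θ₀ i|}) ∪
        {x | ∑ i, (if i ∈ S then 0 else scoreTerm α (x i)) < -(S.card / (4 * α))} := by
    intro x hx
    by_contra hcon
    rw [Set.mem_union, not_or] at hcon
    obtain ⟨hc1, hc2⟩ := hcon
    refine hx ?_
    have hc2' : -(S.card / (4 * α)) ≤ ∑ i, (if i ∈ S then 0 else scoreTerm α (x i)) := not_lt.1 hc2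
    have hbig : ∀ i ∈ S, 1 / (2 * α) ≤ scoreTerm α (x i) := fun i hi => by
      refine one_div_le_scoreTerm h0 (by linarith) (hB _ ?_)
      have hi' : |x i - θ₀ i| < r := by
        by_contra! h
        exact hc1 (Set.mem_biUnion hi h)
      have := (abs_lt.1 hi').1
      rw [hS' i hi] at this
      linarith
    have hsplit : ∑ i, scoreTerm α (x i) = ∑ i, (if i ∈ S then scoreTerm α (x i) else 0) +
        ∑ i, (if i ∈ S then 0 else scoreTerm α (x i)) := by
      rw [← Finset.sum_add_distrib]
      exact Finset.sum_congr rfl fun i _ => by split_ifs <;> simp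
    have hsig : S.card / (2 * α) ≤ ∑ i, (if i ∈ S then scoreTerm α (x i) else 0) := by
      rw [Finset.sum_ite_mem, Finset.univ_inter]
      calc S.card / (2 * α) = ∑ _i ∈ S, 1 / (2 * α) := by simp [div_eq_mul_inv]
        _ ≤ _ := Finset.sum_le_sum hbig
    have he : S.card / (2 * α) = S.card / (4 * α) + S.card / (4 * α) := by field_simp; ring
    have hpos : 0 < S.card / (4 * α) := by positivity
    change 0 < ∑ i, scoreTerm α (x i)
    linarith
  refine (measure_mono hsub).trans ((measure_union_le _ _).trans ?_)
  have hU : law θ₀ (⋃ i ∈ S, {x | r ≤ |x i - θ₀ i|}) ≤ ENNReal.ofReal (1 / 4) := by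
    calc law θ₀ (⋃ i ∈ S, {x | r ≤ |x i - θ₀ i|})
        ≤ ∑ i ∈ S, law θ₀ {x | r ≤ |x i - θ₀ i|} := measure_biUnion_finset_le _ _
      _ ≤ ∑ _i ∈ S, ENNReal.ofReal (1 / 4 / S.card) :=
          Finset.sum_le_sum fun i _ => (law_tail_le θ₀ i hr0).trans_eq (by rw [hr2])
      _ = ENNReal.ofReal (1 / 4) := by
          rw [Finset.sum_const, nsmul_eq_mul, ← ENNReal.ofReal_natCast,
            ← ENNReal.ofReal_mul (by positivity)]
          congr 1
          field_simp
  refine (add_le_add hU (law_null_score_lt_le hs h0 h1 hδ hmean hsq hn θ₀ S hS)).trans_eq ?_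
  rw [← ENNReal.ofReal_add (by norm_num) (by norm_num),
    show (1 / 4 + 1 / 4 : ℝ) = 1 / 2 by norm_num, ENNReal.ofReal_div_of_pos (by norm_num)]
  norm_num

/-! ### The lower bound -/

lemma exists_exp_bound {C : ℝ} (hC : 0 < C) : ∃ R : ℝ, 10 ≤ R ∧ ∀ r : ℝ, R ≤ r →
    Real.exp r * (C * Real.exp (-(9 / 10 * Real.sqrt (2 * (r ^ 2 - r))))) ≤ 1 / 512 := by
  refine ⟨max 10 (512 * C * 10), le_max_left _ _, fun r hr => ?_⟩
  have h10 : 10 ≤ r := (le_max_left _ _).trans hr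
  have hrC : 512 * C * 10 ≤ r := (le_max_right _ _).trans hr
  -- `13/10 < √2` suffices, since `9/10 · 13/10 ≥ 11/10` leaves a factor `e^{-r/10}` to beat `512
  -- C`.
  have hsqrt : 13 / 10 * r ≤ Real.sqrt (2 * (r ^ 2 - r)) := Real.le_sqrt_of_sq_le (by nlinarith)
  have hexp : 512 * C ≤ Real.exp (r / 10) := by linarith [Real.add_one_le_exp (r / 10)]
  calc Real.exp r * (C * Real.exp (-(9 / 10 * Real.sqrt (2 * (r ^ 2 - r)))))
      ≤ Real.exp r * (C * Real.exp (-r + -(r / 10))) := by gcongr; linarith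
    _ = C * Real.exp (-(r / 10)) := by
        rw [Real.exp_add, Real.exp_neg r]; field_simp
    _ ≤ 1 / 512 := by
        rw [Real.exp_neg, ← div_eq_mul_inv, div_le_iff₀ (Real.exp_pos _)]
        linarith

lemma exists_lower_bound : ∃ R : ℝ, ∀ n s : ℕ, 1 ≤ s → 2 * s ≤ n →
    R ≤ Real.sqrt (Real.log ((n : ℝ) / s)) →
      ∃ θ₀ ∈ nearlyBlack n s, ∀ αhat : (Fin n → ℝ) → ℝ, (∀ x, IsMMLE x (αhat x)) →
        ENNReal.ofReal (Real.exp (-10) / 48 * s * Real.exp (Real.sqrt (Real.log ((n : ℝ) / s)))) ≤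
          expectedSecondMoment αhat θ₀ := by
  obtain ⟨C, hC, hmom⟩ := exists_scoreTerm_moment_bounds
  obtain ⟨R, hR10, hR⟩ := exists_exp_bound hC
  refine ⟨R, fun n s hs hsn hRr => ?_⟩
  have hs0 : (0 : ℝ) < s := by exact_mod_cast hs
  have hsn' : 2 * (s : ℝ) ≤ n := by exact_mod_cast hsn
  have hn0 : (0 : ℝ) < n := by linarith
  set r := Real.sqrt (Real.log ((n : ℝ) / s)) with hr
  have hlog : 0 ≤ Real.log ((n : ℝ) / s) :=
    Real.log_nonneg (by rw [le_div_iff₀ hs0]; linarith)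
  have hr10 : 10 ≤ r := hR10.trans hRr
  have hrsq : Real.exp (-r ^ 2) = s / n := by
    rw [hr, Real.sq_sqrt hlog, ← Real.log_inv, Real.exp_log (by positivity), inv_div]
  -- Chosen so that `e^{-T²/2} = e^{-r²} e^r = (s/n) e^r`.
  set T := Real.sqrt (2 * (r ^ 2 - r)) with hT
  have hT2 : 2 ≤ T := Real.le_sqrt_of_sq_le (by nlinarith)
  have hTsq : T ^ 2 / 2 = r ^ 2 - r := by rw [hT, Real.sq_sqrt (by nlinarith)]; ring
  obtain ⟨hmean, hsq⟩ := hmom T hT2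
  set α := Real.exp (-(T ^ 2 / 2)) with hα
  set δ := C * Real.exp (-(9 / 10 * T)) with hδ
  have h0 : 0 < α := Real.exp_pos _
  have h1 : α ≤ 1 / 2 := by
    rw [hα, Real.exp_neg, one_div]
    exact inv_anti₀ two_pos (by nlinarith [Real.add_one_le_exp (T ^ 2 / 2)])
  have hnα : n * α = s * Real.exp r := by
    rw [hα, hTsq, show -(r ^ 2 - r) = -r ^ 2 + r by ring, Real.exp_add, hrsq]
    field_simp
  -- `B` depends on `α`, hence on `n` and `s`; this is harmless, as the size of the nonzero means is
  -- unrestricted.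
  obtain ⟨B, hB⟩ := exists_forall_mul_phi_le_g (1 + 1 / α)
  set S : Finset (Fin n) := Finset.univ.filter fun i => i.val < s with hSdef
  have hScard : S.card = s := by
    rw [hSdef, Fin.card_filter_val_lt, min_eq_right (by omega)]
  set θ₀ : Fin n → ℝ := fun i => if i ∈ S then B + 2 * Real.sqrt S.card else 0 with hθ
  have hS : ∀ i ∉ S, θ₀ i = 0 := fun i hi => by simp [hθ, hi]
  have hS' : ∀ i ∈ S, θ₀ i = B + 2 * Real.sqrt S.card := fun i hi => by simp [hθ, hi]
  refine ⟨θ₀, ?_, fun αhat hhat => ?_⟩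
  · change (Finset.univ.filter fun i => θ₀ i ≠ 0).card ≤ s
    rw [← hScard]
    refine Finset.card_le_card fun i hi => ?_
    by_contra h
    exact (Finset.mem_filter.1 hi).2 (hS i h)
  have hprob := law_score_nonpos_le h0 h1 (by positivity) hmean hsq hB θ₀ S (by omega) (by
    rw [hnα, hScard]
    calc s * Real.exp r * δ = s * (Real.exp r * δ) := by ring
      _ ≤ s * (1 / 512) := by gcongr; exact hR r hRr
      _ = s / 512 := by ring) hS hS'
  have hmeas : MeasurableSet {x : Fin n → ℝ | 0 < ∑ i, scoreTerm α (x i)} :=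
    measurableSet_lt measurable_const (by fun_prop)
  refine le_trans (ENNReal.ofReal_le_ofReal ?_) (le_expectedSecondMoment h0.le θ₀ Sᶜ
    (fun i hi => hS i (Finset.mem_compl.1 hi)) hmeas hprob (fun x => (hhat x).1.2)
    fun x hx => le_of_isMMLE_of_score_pos (by linarith) hx (hhat x))
  -- Since `2s ≤ n`, at least half of the means vanish; this turns the constant `1/24` into `1/48`.
  have hcard : (n : ℝ) / 2 ≤ (Sᶜ.card : ℝ) := by
    rw [Finset.card_compl, hScard, Fintype.card_fin, Nat.cast_sub (by omega)]
    linarith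
  calc Real.exp (-10) / 48 * s * Real.exp r = Real.exp (-10) / 48 * (s * Real.exp r) := by ring
    _ = n / 2 * (Real.exp (-10) / 24 * α) := by rw [← hnα]; ring
    _ ≤ _ := by gcongr

lemma le_sqrt_log_div {n s : ℕ} {R c : ℝ} (hs : 1 ≤ s) (hc : c ≤ Real.exp (-R ^ 2))
    (hsn : (s : ℝ) ≤ c * n) : R ≤ Real.sqrt (Real.log ((n : ℝ) / s)) := by
  have hs0 : (0 : ℝ) < s := by exact_mod_cast hs
  have hle : (s : ℝ) ≤ Real.exp (-R ^ 2) * n := hsn.trans (by gcongr)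
  have hdiv : Real.exp (R ^ 2) ≤ (n : ℝ) / s := by
    rw [le_div_iff₀ hs0]
    calc Real.exp (R ^ 2) * s ≤ Real.exp (R ^ 2) * (Real.exp (-R ^ 2) * n) := by gcongr
      _ = n := by rw [← mul_assoc, ← Real.exp_add]; simp
  refine Real.le_sqrt_of_sq_le ?_
  rwa [Real.le_log_iff_exp_le ((Real.exp_pos _).trans_le hdiv)]

end SpikeSlab

theorem theorem1 :
    ∃ (D : ℝ) (N₀ : ℕ) (c₀ : ℝ), 0 < D ∧ 0 < N₀ ∧ 0 < c₀ ∧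
      (∀ n : ℕ, N₀ ≤ n → ∀ s : ℕ, 1 ≤ s → (s : ℝ) ≤ c₀ * n →
        ∃ θ₀ ∈ SpikeSlab.nearlyBlack n s,
          ∀ αhat : (Fin n → ℝ) → ℝ, (∀ x, SpikeSlab.IsMMLE x (αhat x)) →
            ENNReal.ofReal (D * s * Real.exp (Real.sqrt (Real.log ((n : ℝ) / s)))) ≤
              SpikeSlab.expectedSecondMoment αhat θ₀) ∧
      (∀ K : ℝ, 0 < K → ∃ c : ℝ, 0 < c ∧
        ∀ n : ℕ, N₀ ≤ n → ∀ s : ℕ, 1 ≤ s → (s : ℝ) ≤ c * n →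
          ∃ θ₀ ∈ SpikeSlab.nearlyBlack n s,
            ∀ αhat : (Fin n → ℝ) → ℝ, (∀ x, SpikeSlab.IsMMLE x (αhat x)) →
              ENNReal.ofReal (K * (s * Real.log ((n : ℝ) / s))) ≤
                SpikeSlab.expectedSecondMoment αhat θ₀) := by
  obtain ⟨R, hR⟩ := SpikeSlab.exists_lower_bound
  have half : ∀ {c : ℝ} {n s : ℕ}, c ≤ 1 / 2 → (s : ℝ) ≤ c * n → 2 * s ≤ n := by
    intro c n s hc hs
    have h : (s : ℝ) ≤ 1 / 2 * n := hs.trans (by gcongr)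
    have : 2 * (s : ℝ) ≤ n := by linarith
    exact_mod_cast this
  refine ⟨Real.exp (-10) / 48, 1, min (1 / 2) (Real.exp (-R ^ 2)), by positivity, one_pos,
    by positivity, fun n _ s hs hsn => ?_, fun K hK => ?_⟩
  · exact hR n s hs (half (min_le_left _ _) hsn)
      (SpikeSlab.le_sqrt_log_div hs (min_le_right _ _) hsn)
  -- With `D = e^{-10}/48`, the bound `r ≥ 6K/D` gives `K r² ≤ D r³/6 ≤ D e^r`.
  · set R' := max (max R 0) (6 * K / (Real.exp (-10) / 48)) with hR'
    refine ⟨min (1 / 2) (Real.exp (-R' ^ 2)), by positivity, fun n _ s hs hsn => ?_⟩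
    have hr := SpikeSlab.le_sqrt_log_div hs (min_le_right _ _) hsn
    have hsn2 := half (min_le_left _ _) hsn
    obtain ⟨θ₀, hθ, hle⟩ := hR n s hs hsn2
      (((le_max_left _ _).trans (le_max_left _ _)).trans hr)
    refine ⟨θ₀, hθ, fun αhat hhat => le_trans (ENNReal.ofReal_le_ofReal ?_) (hle αhat hhat)⟩
    have hs0 : (0 : ℝ) < s := by exact_mod_cast hs
    have hlog : 0 ≤ Real.log ((n : ℝ) / s) := by
      refine Real.log_nonneg ?_
      rw [le_div_iff₀ hs0]
      have : 2 * (s : ℝ) ≤ n := by exact_mod_cast hsn2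
      linarith
    set r := Real.sqrt (Real.log ((n : ℝ) / s)) with hrdef
    have hr0 : 0 ≤ r := Real.sqrt_nonneg _
    have hK' : 6 * K ≤ Real.exp (-10) / 48 * r := by
      rw [← div_le_iff₀' (by positivity)]
      exact (le_max_right _ _).trans hr
    have hexp : r ^ 3 / 6 ≤ Real.exp r := by
      simpa [Nat.factorial] using Real.pow_div_factorial_le_exp r hr0 3
    calc K * (s * Real.log ((n : ℝ) / s)) = s * (6 * K * (r ^ 2 / 6)) := by
          rw [hrdef, Real.sq_sqrt hlog]; ring
      _ ≤ s * (Real.exp (-10) / 48 * r * (r ^ 2 / 6)) := by gcongr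
      _ = Real.exp (-10) / 48 * s * (r ^ 3 / 6) := by ring
      _ ≤ _ := by gcongr
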